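/- Let $\mathbb N=\{1,2,\dots\}$, $\mathbb N_0=\{0,1,2,\dots\}$, and let $\{p_{k,\ell}\}_{(k,\ell)\in\mathbb Z^2}$ and $\{q_{k,\ell}\}_{(k,\ell)\in\mathbb Z^2}$ be non-negative weights such that * (A1) $\sum_{k,\ell}p_{k,\ell}=\sum_{k,\ell}q_{k,\ell}=1$; * (A2) $p_{k,\ell}=0$ whenever $k\le -2$ or $\ell\le -2$; * (A3) $p_{k,-1}\,p_{-1,\ell}>0$ for some $k,\ell$; * (A4) the series $\sum_{k,\ell}k\,p_{k,\ell}$ and $\sum_{k,\ell}\ell\,p_{k,\ell}$ converge absolutely, with values in $(0,\infty)$; * (A5) $q_{k,\ell}=0$ whenever $k\le -1$ or $\ell\le -1$; * (A6) the series $\sum_{k,\ell}k\,q_{k,\ell}$ and $\sum_{k,\ell}\ell\,q_{k,\ell}$ converge absolutely, with values in $(0,\infty)$. Let $\xi,\eta$ be $\mathbb Z^2$-valued random variables with $\mathbf P(\xi=(k,\ell))=p_{k,\ell}$ and $\mathbf P(\eta=(k,\ell))=q_{k,\ell}$, and let $\{\xi_n\}_{n\ge0}$ and $\{\eta_n\}_{n\ge0}$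 be sequences of independent copies of $\xi$ and $\eta$ such that the pairs $(\xi_n,\eta_n)$, $n\ge 0$, are independent (for example, two independent i.i.d. sequences). For $x\in\mathbb N_0^2$ define the reflected random walk $$S_0^x=x,\qquad S_{n+1}^x=S_n^x+\xi_{n+1}\mathbf 1_{\{S_n^x\in\mathbb N^2\}}+\eta_{n+1}\mathbf 1_{\{S_n^x\in\mathbb N_0^2\setminus\mathbb N^2\}},\quad n\ge0,$$ and its number of boundary contacts $Z_x=\sum_{n\ge0}\mathbf 1_{\{S_n^x\in\mathbb N_0^2\setminus\mathbb N^2\}}\in\mathbb N_0\cup\{\infty\}$. Then each of the equations $$\alpha=\sum_{k,\ell}p_{k,\ell}\,\alpha^{k+1}\qquad\text{and}\qquad \beta=\sum_{k,\ell}p_{k,\ell}\,\beta^{\ell+1}$$ has a unique solution in $(0,1)$; denote these solutions by $\alpha_1$ and $\beta_{-1}$, respectively. Moreover, for every $x=(i,j)\in\mathbb N_0^2$, as $n\to\infty$, $$\mathbf P(Z_x>n)\asymp \alpha_1^{\,i}\left(\mathbf E\,\alpha_1^{\Pi_1(\eta)}\right)^n+\beta_{-1}^{\,j}\left(\mathbf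 E\,\beta_{-1}^{\Pi_2(\eta)}\right)^n,$$ where $\Pi_1,\Pi_2$ are the projections onto the first and second coordinates, and $a_n\asymp b_n$ means that there are constants $c_1,c_2>0$ with $c_1\le a_n/b_n\le c_2$ for all sufficiently large $n$. -/

import Mathlib

open MeasureTheory ProbabilityTheory Filter
open scoped ENNReal

noncomputable section

namespace QuadrantWalk

/-- The quadrant `ℕ₀²`, as a subset of `ℤ²`. -/
def quadrant : Set (ℤ × ℤ) := {z | 0 ≤ z.1 ∧ 0 ≤ z.2}

/-- The interior `ℕ²` of the quadrant, where `ℕ = {1, 2, …}`. -/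
def interior : Set (ℤ × ℤ) := {z | 1 ≤ z.1 ∧ 1 ≤ z.2}

/-- The boundary `ℕ₀² ∖ ℕ²` of the quadrant. -/
def boundary : Set (ℤ × ℤ) := quadrant \ interior

/-- The path of the reflected walk from `x` driven by the interior steps `ξ` and the boundary
steps `η`: `S 0 = x` and
`S (n+1) = S n + ξ (n+1) · 1{S n ∈ ℕ²} + η (n+1) · 1{S n ∈ ℕ₀² ∖ ℕ²}`. -/
def walk (ξ η : ℕ → ℤ × ℤ) (x : ℤ × ℤ) : ℕ → ℤ × ℤ
  | 0 => x
  | n + 1 =>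
      walk ξ η x n + interior.indicator (fun _ => ξ (n + 1)) (walk ξ η x n)
        + boundary.indicator (fun _ => η (n + 1)) (walk ξ η x n)

/-- The number of boundary contacts `∑_{n ≥ 0} 1{S n ∈ ℕ₀² ∖ ℕ²}` of a path, possibly infinite. -/
def contacts (S : ℕ → ℤ × ℤ) : ℝ≥0∞ :=
  ∑' n, boundary.indicator (fun _ => (1 : ℝ≥0∞)) (S n)

/-- The standing assumptions on the weights `p` (interior steps) and `q` (boundary steps). -/
structure Assumptions (p q : ℤ × ℤ → ℝ) : Prop where
  p_nonneg : ∀ z, 0 ≤ p z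
  q_nonneg : ∀ z, 0 ≤ q z
  /-- normalization -/
  p_sum : HasSum p 1
  q_sum : HasSum q 1
  /-- small negative jumps: no coordinate of an interior step is below `-1` -/
  p_small : ∀ k l : ℤ, k ≤ -2 ∨ l ≤ -2 → p (k, l) = 0
  /-- existence of negative jumps in both directions -/
  p_neg : ∃ k l : ℤ, 0 < p (k, -1) * p (-1, l)
  /-- finite positive drift in the interior -/
  p_drift_fst : Summable (fun z : ℤ × ℤ => (z.1 : ℝ) * p z) ∧ 0 < ∑' z : ℤ × ℤ, (z.1 : ℝ) * p z
  p_drift_snd : Summable (fun z : ℤ × ℤ => (z.2 : ℝ) * p z) ∧ 0 < ∑' z : ℤ × ℤ, (z.2 : ℝ) * p z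
  /-- no coordinate of a boundary step is negative -/
  q_nonneg_jumps : ∀ k l : ℤ, k ≤ -1 ∨ l ≤ -1 → q (k, l) = 0
  /-- finite positive drift on the boundary -/
  q_drift_fst : Summable (fun z : ℤ × ℤ => (z.1 : ℝ) * q z) ∧ 0 < ∑' z : ℤ × ℤ, (z.1 : ℝ) * q z
  q_drift_snd : Summable (fun z : ℤ × ℤ => (z.2 : ℝ) * q z) ∧ 0 < ∑' z : ℤ × ℤ, (z.2 : ℝ) * q z

/-- `α ∈ (0,1)` solves `α = ∑_{k,l} p_{k,l} α^{k+1}`. -/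
def IsRootFst (p : ℤ × ℤ → ℝ) (α : ℝ) : Prop :=
  α ∈ Set.Ioo (0 : ℝ) 1 ∧ HasSum (fun z : ℤ × ℤ => p z * α ^ (z.1 + 1)) α

/-- `β ∈ (0,1)` solves `β = ∑_{k,l} p_{k,l} β^{l+1}`. -/
def IsRootSnd (p : ℤ × ℤ → ℝ) (β : ℝ) : Prop :=
  β ∈ Set.Ioo (0 : ℝ) 1 ∧ HasSum (fun z : ℤ × ℤ => p z * β ^ (z.2 + 1)) β

/-- `a n ≍ b n` as `n → ∞`. -/
def Asymp (a b : ℕ → ℝ) : Prop :=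
  ∃ c₁ c₂ : ℝ, 0 < c₁ ∧ 0 < c₂ ∧ ∀ᶠ n in atTop, c₁ ≤ a n / b n ∧ a n / b n ≤ c₂

end QuadrantWalk

end

/-! Dividing the equation for α by α gives `E α^ξ₁ = 1`, so the weight `α^z₁` is harmonic under
interior steps, while a boundary step multiplies it in mean by `a = E α^η₁ < 1`. Optional stopping
at the contact number `n + 1` then yields the exact identity that the mean of `α^z₁` at that
contact, on the event that it occurs, equals `α^i a^n`; likewise `β^j b^n` for the second coordinate
(`tsum_lintegral_expWeight_contactStates`).

On the boundary one coordinate vanishes and the other is nonnegative, so each weight is at most 1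
and their sum is at least 1. Hence `P(Z > n)` dominates each of the two terms and is dominated by
their sum.

Optional stopping needs the mean weight of the walk to vanish as time grows. Positive drift supplies
a base `u` between α and 1 with `E u^ξ₁ < 1` and `E u^η₁ < 1`; the mean of `u^S₁` decays
geometrically and dominates that of `α^S₁` in the quadrant. The roots themselves are extinction
probabilities of generating functions with mean above 1. -/

namespace QuadrantWalk

/-! ### Generating functions with mean above 1 -/

section GeneratingFunction

variable {ι : Type*} {w : ι → ℝ} {N : ι → ℕ}

lemma summable_mul_pow (hw : ∀ i, 0 ≤ w i) (h1 : Summable w) {t : ℝ} (ht : t ∈ Set.Icc (0 : ℝ) 1) :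
    Summable fun i => w i * t ^ N i :=
  h1.of_nonneg_of_le (fun i => mul_nonneg (hw i) (pow_nonneg ht.1 _))
    fun i => mul_le_of_le_one_right (hw i) (pow_le_one₀ ht.1 ht.2)

lemma continuousOn_tsum_mul_pow (hw : ∀ i, 0 ≤ w i) (h1 : Summable w) :
    ContinuousOn (fun t : ℝ => ∑' i, w i * t ^ N i) (Set.Icc 0 1) := by
  refine continuousOn_tsum (fun i => by fun_prop) h1 fun i t ht => ?_
  rw [Real.norm_of_nonneg (mul_nonneg (hw i) (pow_nonneg ht.1 _))]
  exact mul_le_of_le_one_right (hw i) (pow_le_one₀ ht.1 ht.2)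

lemma convexOn_tsum_mul_pow (hw : ∀ i, 0 ≤ w i) (h1 : Summable w) :
    ConvexOn ℝ (Set.Icc 0 1) (fun t : ℝ => ∑' i, w i * t ^ N i) := by
  refine ⟨convex_Icc 0 1, fun x hx y hy a b ha hb hab => ?_⟩
  have hx' := summable_mul_pow (N := N) hw h1 hx
  have hy' := summable_mul_pow (N := N) hw h1 hy
  simp only [smul_eq_mul]
  rw [← tsum_mul_left, ← tsum_mul_left, ← (hx'.mul_left a).tsum_add (hy'.mul_left b)]
  refine (summable_mul_pow hw h1 (convex_Icc 0 1 hx hy ha hb hab)).tsum_le_tsum (fun i => ?_)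
    ((hx'.mul_left a).add (hy'.mul_left b))
  have := (convexOn_pow (𝕜 := ℝ) (N i)).2 hx.1 hy.1 ha hb hab
  simp only [smul_eq_mul] at this ⊢
  nlinarith [mul_le_mul_of_nonneg_left this (hw i)]

/-- A generating function with mean larger than `1` lies below the diagonal to the left of `1`. -/
lemma exists_tsum_mul_pow_lt (hw : ∀ i, 0 ≤ w i) (h1 : HasSum w 1)
    (hN : Summable fun i => (N i : ℝ) * w i) (hmean : 1 < ∑' i, (N i : ℝ) * w i)
    {a : ℝ} (ha : a < 1) :
    ∃ t ∈ Set.Ioo a 1, 0 < t ∧ ∑' i, w i * t ^ N i < t := by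
  -- The sum is the difference quotient `(1 - f t) / (1 - t)` of the generating function `f`; it
  -- tends to the mean by domination with `N i * w i`.
  have hlim : Tendsto (fun t : ℝ => ∑' i, (∑ k ∈ Finset.range (N i), t ^ k) * w i)
      (nhdsWithin 1 (Set.Ioo 0 1)) (nhds (∑' i, (N i : ℝ) * w i)) := by
    refine tendsto_tsum_of_dominated_convergence hN (fun i => ?_) ?_
    · have : Continuous fun t : ℝ => (∑ k ∈ Finset.range (N i), t ^ k) * w i := by fun_prop
      simpa using (this.tendsto 1).mono_left nhdsWithin_le_nhds
    · filter_upwards [self_mem_nhdsWithin] with t ht i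
      have h0 : 0 ≤ ∑ k ∈ Finset.range (N i), t ^ k :=
        Finset.sum_nonneg fun k _ => pow_nonneg ht.1.le k
      rw [Real.norm_of_nonneg (mul_nonneg h0 (hw i))]
      refine mul_le_mul_of_nonneg_right ?_ (hw i)
      simpa using Finset.sum_le_sum fun k (_ : k ∈ Finset.range (N i)) =>
        pow_le_one₀ (n := k) ht.1.le ht.2.le
  have hne : (nhdsWithin (1 : ℝ) (Set.Ioo 0 1)).NeBot :=
    right_nhdsWithin_Ioo_neBot zero_lt_one
  obtain ⟨t, ⟨ht, hta⟩, ht01⟩ := ((hlim.eventually (lt_mem_nhds hmean)).and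
    (nhdsWithin_le_nhds (lt_mem_nhds ha))).and self_mem_nhdsWithin |>.exists
  refine ⟨t, ⟨hta, ht01.2⟩, ht01.1, ?_⟩
  have hs := summable_mul_pow (N := N) hw h1.summable ⟨ht01.1.le, ht01.2.le⟩
  have hkey : (1 - t) * ∑' i, (∑ k ∈ Finset.range (N i), t ^ k) * w i
      = 1 - ∑' i, w i * t ^ N i := by
    rw [← tsum_mul_left]
    nth_rewrite 2 [← h1.tsum_eq]
    rw [← h1.summable.tsum_sub hs]
    refine tsum_congr fun i => ?_
    rw [← mul_assoc, mul_neg_geom_sum]; ring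
  nlinarith [mul_lt_mul_of_pos_left ht (sub_pos.2 ht01.2)]

/-- Existence and uniqueness of the extinction probability. -/
lemma existsUnique_tsum_mul_pow_eq (hw : ∀ i, 0 ≤ w i) (h1 : HasSum w 1)
    (hN : Summable fun i => (N i : ℝ) * w i) (hmean : 1 < ∑' i, (N i : ℝ) * w i)
    (h0 : ∃ i, N i = 0 ∧ 0 < w i) :
    ∃! t : ℝ, t ∈ Set.Ioo (0 : ℝ) 1 ∧ ∑' i, w i * t ^ N i = t := by
  have hzero : 0 < ∑' i, w i * (0 : ℝ) ^ N i := by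
    obtain ⟨i, hi, hwi⟩ := h0
    refine (summable_mul_pow hw h1.summable (by simp)).tsum_pos
      (fun i => mul_nonneg (hw i) (pow_nonneg le_rfl _)) i ?_
    simpa [hi] using hwi
  have huniq : ∀ s t : ℝ, s ∈ Set.Ioo (0 : ℝ) 1 → t ∈ Set.Ioo (0 : ℝ) 1 →
      ∑' i, w i * s ^ N i = s → ∑' i, w i * t ^ N i = t → ¬ s < t := by
    intro s t hs ht hse hte hst
    -- Two roots `s < t` contradict convexity: `t` lies on the segment from `s` to a point `u` where
    -- the function is strictly below the diagonal.
    obtain ⟨u, hu, hu0, hlt⟩ := exists_tsum_mul_pow_lt hw h1 hN hmean ht.2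
    have hpos : 0 < u - s := by linarith [hu.1]
    have hc := (convexOn_tsum_mul_pow (N := N) hw h1.summable).2 ⟨hs.1.le, hs.2.le⟩
      ⟨hu0.le, hu.2.le⟩
      (div_nonneg (sub_nonneg.2 hu.1.le) hpos.le) (div_nonneg (sub_nonneg.2 hst.le) hpos.le)
      (by field_simp; ring)
    have hcomb : (u - t) / (u - s) * s + (t - s) / (u - s) * u = t := by field_simp; ring
    simp only [smul_eq_mul] at hc
    rw [hcomb, hte, hse] at hc
    have := mul_lt_mul_of_pos_left hlt (div_pos (sub_pos.2 hst) hpos)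
    linarith
  obtain ⟨u, hu, -, hlt⟩ := exists_tsum_mul_pow_lt hw h1 hN hmean zero_lt_one
  have hcont : ContinuousOn (fun t : ℝ => (∑' i, w i * t ^ N i) - t) (Set.Icc 0 u) :=
    ((continuousOn_tsum_mul_pow hw h1.summable).mono
      (Set.Icc_subset_Icc_right hu.2.le)).sub continuousOn_id
  obtain ⟨t, ht, hte⟩ := intermediate_value_Ioo' hu.1.le hcont
    (show (0 : ℝ) ∈ Set.Ioo _ _ from ⟨by linarith, by simpa using hzero⟩)
  refine ⟨t, ⟨⟨ht.1, ht.2.trans hu.2⟩, sub_eq_zero.1 hte⟩, fun s hs => ?_⟩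
  have ht' : t ∈ Set.Ioo (0 : ℝ) 1 := ⟨ht.1, ht.2.trans hu.2⟩
  exact le_antisymm (not_lt.1 (huniq t s ht' hs.1 (sub_eq_zero.1 hte) hs.2))
    (not_lt.1 (huniq s t hs.1 ht' hs.2 (sub_eq_zero.1 hte)))

end GeneratingFunction

/-! ### Laurent series with exponents at least -1 -/

section IntegerExponents

variable {ι : Type*} {w : ι → ℝ} {c : ι → ℤ}

/-- Truncation by `toNat` alters only negative exponents, where the weight is zero, so the shifted
Laurent series is a genuine generating function. -/
lemma mul_zpow_eq_mul_pow_toNat (hc : ∀ i, c i ≤ -2 → w i = 0) (t : ℝ) (i : ι) :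
    w i * t ^ (c i + 1) = w i * t ^ (c i + 1).toNat := by
  rcases le_or_gt (c i) (-2) with h | h
  · simp [hc i h]
  · rw [← zpow_natCast, Int.toNat_of_nonneg (by omega)]

lemma toNat_add_one_mul (hc : ∀ i, c i ≤ -2 → w i = 0) (i : ι) :
    ((c i + 1).toNat : ℝ) * w i = (c i : ℝ) * w i + w i := by
  rcases le_or_gt (c i) (-2) with h | h
  · simp [hc i h]
  · have : ((c i + 1).toNat : ℝ) = (c i : ℝ) + 1 := by
      exact_mod_cast congrArg (Int.cast : ℤ → ℝ) (Int.toNat_of_nonneg (a := c i + 1) (by omega))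
    rw [this]; ring

/-- The shift by one adds total mass 1 to the mean, so positive drift becomes mean above 1. -/
lemma one_lt_tsum_toNat_mul (h1 : HasSum w 1) (hc : ∀ i, c i ≤ -2 → w i = 0)
    (hd : Summable (fun i => (c i : ℝ) * w i) ∧ 0 < ∑' i, (c i : ℝ) * w i) :
    Summable (fun i => ((c i + 1).toNat : ℝ) * w i) ∧
      1 < ∑' i, ((c i + 1).toNat : ℝ) * w i := by
  simp only [toNat_add_one_mul hc]
  refine ⟨hd.1.add h1.summable, ?_⟩
  rw [hd.1.tsum_add h1.summable, h1.tsum_eq]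
  linarith [hd.2]

lemma hasSum_zpow_iff (hw : ∀ i, 0 ≤ w i) (h1 : HasSum w 1) (hc : ∀ i, c i ≤ -2 → w i = 0)
    {t : ℝ} (ht : t ∈ Set.Ioo (0 : ℝ) 1) {s : ℝ} :
    HasSum (fun i => w i * t ^ (c i + 1)) s ↔ ∑' i, w i * t ^ (c i + 1).toNat = s := by
  simp only [mul_zpow_eq_mul_pow_toNat hc]
  exact (summable_mul_pow hw h1.summable ⟨ht.1.le, ht.2.le⟩).hasSum_iff

lemma existsUnique_zpow_root (hw : ∀ i, 0 ≤ w i) (h1 : HasSum w 1) (hc : ∀ i, c i ≤ -2 → w i = 0)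
    (hd : Summable (fun i => (c i : ℝ) * w i) ∧ 0 < ∑' i, (c i : ℝ) * w i)
    (h0 : ∃ i, c i = -1 ∧ 0 < w i) :
    ∃! t : ℝ, t ∈ Set.Ioo (0 : ℝ) 1 ∧ HasSum (fun i => w i * t ^ (c i + 1)) t := by
  obtain ⟨hN, hm⟩ := one_lt_tsum_toNat_mul h1 hc hd
  obtain ⟨t, ht, hu⟩ := existsUnique_tsum_mul_pow_eq hw h1 hN hm
    (by obtain ⟨i, hi, hwi⟩ := h0; exact ⟨i, by simp [hi], hwi⟩)
  exact ⟨t, ⟨ht.1, (hasSum_zpow_iff hw h1 hc ht.1).2 ht.2⟩,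
    fun s hs => hu s ⟨hs.1, (hasSum_zpow_iff hw h1 hc hs.1).1 hs.2⟩⟩

/-- To the right of any `a < 1` the Laurent series `∑ w i * t ^ c i` takes a value below `1`. -/
lemma exists_hasSum_zpow_lt_one (hw : ∀ i, 0 ≤ w i) (h1 : HasSum w 1)
    (hc : ∀ i, c i ≤ -2 → w i = 0)
    (hd : Summable (fun i => (c i : ℝ) * w i) ∧ 0 < ∑' i, (c i : ℝ) * w i) {a : ℝ} (ha : a < 1) :
    ∃ t ∈ Set.Ioo a 1, 0 < t ∧ ∃ s < 1, HasSum (fun i => w i * t ^ c i) s := by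
  obtain ⟨hN, hm⟩ := one_lt_tsum_toNat_mul h1 hc hd
  obtain ⟨t, ht, ht0, hlt⟩ := exists_tsum_mul_pow_lt hw h1 hN hm ha
  refine ⟨t, ht, ht0, _, (div_lt_one ht0).2 hlt, ?_⟩
  have heq : (fun i => w i * t ^ c i) = fun i => w i * t ^ (c i + 1) / t := funext fun i => by
    rw [zpow_add_one₀ ht0.ne', ← mul_assoc, mul_div_cancel_right₀ _ ht0.ne']
  rw [heq]
  exact ((hasSum_zpow_iff hw h1 hc ⟨ht0, ht.2⟩).2 rfl).div_const t

/-- Nonnegative, nontrivial jumps contract. -/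
lemma exists_hasSum_zpow_mem_Ioo (hw : ∀ i, 0 ≤ w i) (h1 : HasSum w 1)
    (hc : ∀ i, c i ≤ -1 → w i = 0) (hd : 0 < ∑' i, (c i : ℝ) * w i)
    {t : ℝ} (ht : t ∈ Set.Ioo (0 : ℝ) 1) :
    ∃ s ∈ Set.Ioo (0 : ℝ) 1, HasSum (fun i => w i * t ^ c i) s := by
  have hle : ∀ i, w i * t ^ c i ≤ w i := fun i => by
    rcases le_or_gt (c i) (-1) with h | h
    · simp [hc i h]
    · exact mul_le_of_le_one_right (hw i) (zpow_le_one₀ ht.1 ht.2.le (by omega))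
  have hnn : ∀ i, 0 ≤ w i * t ^ c i := fun i => mul_nonneg (hw i) (zpow_nonneg ht.1.le _)
  have hs := h1.summable.of_nonneg_of_le hnn hle
  -- Positive drift forces a strictly positive jump of positive weight, which makes the comparison
  -- with total mass 1 strict.
  obtain ⟨i, hi⟩ : ∃ i, 0 < (c i : ℝ) * w i := by
    by_contra! h
    exact absurd hd (not_lt.2 (tsum_nonpos h))
  have hwi : 0 < w i := (hw i).lt_of_ne fun h => by simp [← h] at hi
  have hci : 0 < c i := by
    have := (pos_iff_pos_of_mul_pos hi).2 hwi
    exact_mod_cast this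
  refine ⟨_, ⟨hs.tsum_pos hnn i (mul_pos hwi (zpow_pos ht.1 _)), ?_⟩, hs.hasSum⟩
  rw [← h1.tsum_eq]
  exact hs.tsum_lt_tsum hle (i := i)
    (mul_lt_of_lt_one_right hwi (zpow_lt_one₀ ht.1 ht.2 hci)) h1.summable

end IntegerExponents

end QuadrantWalk

/-! ### Contact counts along a deterministic path -/

namespace QuadrantWalk

/-- The number of boundary contacts of a path strictly before time `n`. -/
noncomputable def contactsBefore (S : ℕ → ℤ × ℤ) (n : ℕ) : ℕ :=
  ∑ k ∈ Finset.range n, boundary.indicator (fun _ => 1) (S k)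

section Paths

lemma contactsBefore_succ (S : ℕ → ℤ × ℤ) (n : ℕ) :
    contactsBefore S (n + 1) = contactsBefore S n + boundary.indicator (fun _ => 1) (S n) :=
  Finset.sum_range_succ _ _

lemma contactsBefore_succ_of_mem {S : ℕ → ℤ × ℤ} {n : ℕ} (h : S n ∈ boundary) :
    contactsBefore S (n + 1) = contactsBefore S n + 1 := by
  simp [contactsBefore_succ, h]

lemma contactsBefore_succ_of_notMem {S : ℕ → ℤ × ℤ} {n : ℕ} (h : S n ∉ boundary) :
    contactsBefore S (n + 1) = contactsBefore S n := by
  simp [contactsBefore_succ, h]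

lemma contactsBefore_mono (S : ℕ → ℤ × ℤ) : Monotone (contactsBefore S) :=
  monotone_nat_of_le_succ fun n => by simp [contactsBefore_succ]

lemma contacts_eq_iSup (S : ℕ → ℤ × ℤ) : contacts S = ⨆ m, (contactsBefore S m : ℝ≥0∞) := by
  rw [contacts, ENNReal.tsum_eq_iSup_nat]
  congr! with m
  rw [contactsBefore, Nat.cast_sum]
  refine Finset.sum_congr rfl fun k _ => ?_
  by_cases h : S k ∈ boundary <;> simp [h]

/-- More than `n` contacts occur iff there is a time of the contact number `n + 1`. -/
lemma lt_contacts_iff (S : ℕ → ℤ × ℤ) (n : ℕ) :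
    (n : ℝ≥0∞) < contacts S ↔ ∃ m, S m ∈ boundary ∧ contactsBefore S m = n := by
  rw [contacts_eq_iSup, lt_iSup_iff]
  simp only [Nat.cast_lt]
  constructor
  · rintro ⟨m, hm⟩
    induction m with
    | zero => simp [contactsBefore] at hm
    | succ m ih =>
      by_cases h : n < contactsBefore S m
      · exact ih h
      · by_cases hb : S m ∈ boundary
        · rw [contactsBefore_succ_of_mem hb] at hm
          exact ⟨m, hb, by omega⟩
        · rw [contactsBefore_succ_of_notMem hb] at hm
          exact absurd hm h
  · rintro ⟨m, hb, hm⟩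
    exact ⟨m + 1, by rw [contactsBefore_succ_of_mem hb]; omega⟩

/-- The contact number `n + 1` happens at most once. -/
lemma eq_of_contactsBefore_eq {S : ℕ → ℤ × ℤ} {n k m : ℕ} (hk : S k ∈ boundary)
    (hkn : contactsBefore S k = n) (hm : S m ∈ boundary) (hmn : contactsBefore S m = n) :
    k = m := by
  by_contra hne
  rcases lt_or_gt_of_ne hne with h | h
  · have := contactsBefore_mono S (Nat.succ_le_of_lt h)
    rw [Nat.succ_eq_add_one, contactsBefore_succ_of_mem hk] at this
    omega
  · have := contactsBefore_mono S (Nat.succ_le_of_lt h)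
    rw [Nat.succ_eq_add_one, contactsBefore_succ_of_mem hm] at this
    omega

variable {ξ η ξ' η' : ℕ → ℤ × ℤ} {x : ℤ × ℤ}

lemma walk_congr {m : ℕ} (h : ∀ k ≤ m, ξ k = ξ' k ∧ η k = η' k) :
    walk ξ η x m = walk ξ' η' x m := by
  induction m with
  | zero => rfl
  | succ m ih =>
    simp only [walk, ih fun k hk => h k (by omega), (h (m + 1) le_rfl).1, (h (m + 1) le_rfl).2]

lemma contactsBefore_walk_congr {m : ℕ} (h : ∀ k ≤ m, ξ k = ξ' k ∧ η k = η' k) :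
    contactsBefore (walk ξ η x) m = contactsBefore (walk ξ' η' x) m := by
  refine Finset.sum_congr rfl fun k hk => ?_
  rw [walk_congr fun l hl => h l (hl.trans (Finset.mem_range.1 hk).le)]

lemma walk_succ_of_mem_interior {m : ℕ} (h : walk ξ η x m ∈ interior) :
    walk ξ η x (m + 1) = walk ξ η x m + ξ (m + 1) := by
  have hb : walk ξ η x m ∉ boundary := fun hb => hb.2 h
  simp [walk, h, hb]

lemma walk_succ_of_mem_boundary {m : ℕ} (h : walk ξ η x m ∈ boundary) :
    walk ξ η x (m + 1) = walk ξ η x m + η (m + 1) := by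
  simp [walk, h, h.2]

lemma walk_mem_quadrant (hx : x ∈ quadrant) (hξ : ∀ m, -1 ≤ (ξ m).1 ∧ -1 ≤ (ξ m).2)
    (hη : ∀ m, 0 ≤ (η m).1 ∧ 0 ≤ (η m).2) (m : ℕ) : walk ξ η x m ∈ quadrant := by
  induction m with
  | zero => exact hx
  | succ m ih =>
    by_cases h : walk ξ η x m ∈ interior
    · rw [walk_succ_of_mem_interior h]
      have h1 := h.1
      have h2 := h.2
      exact ⟨by rw [Prod.fst_add]; linarith [(hξ (m + 1)).1],
        by rw [Prod.snd_add]; linarith [(hξ (m + 1)).2]⟩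
    · rw [walk_succ_of_mem_boundary ⟨ih, h⟩]
      exact ⟨add_nonneg ih.1 (hη _).1, add_nonneg ih.2 (hη _).2⟩

end Paths

/-! ### Expectations and the one-step identity -/

section Expectations

variable {Ω : Type*} [MeasurableSpace Ω] {P : Measure Ω}

/-- Countably many null events are discarded at once. This turns vanishing weights into almost sure
bounds on the steps. -/
lemma ae_ne_zero_of_measureReal_eq [IsFiniteMeasure P] {ι : Type*} [Countable ι] {p : ι → ℝ}
    {X : Ω → ι} (hX : ∀ z, P.real {ω | X ω = z} = p z) : ∀ᵐ ω ∂P, p (X ω) ≠ 0 := by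
  have : ∀ z, ∀ᵐ ω ∂P, p z = 0 → X ω ≠ z := fun z => by
    by_cases hz : p z = 0
    · have h := hX z
      rw [hz, measureReal_eq_zero_iff] at h
      filter_upwards [measure_eq_zero_iff_ae_notMem.1 h] with ω hω _ using hω
    · exact Eventually.of_forall fun ω h => absurd h hz
  filter_upwards [ae_all_iff.2 this] with ω hω h using hω _ h rfl

lemma lintegral_ofReal_zpow [IsFiniteMeasure P] {ι : Type*} [Countable ι] [MeasurableSpace ι]
    [MeasurableSingletonClass ι] {p : ι → ℝ} (hp : ∀ z, 0 ≤ p z) {X : Ω → ι} (hXm : Measurable X)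
    (hX : ∀ z, P.real {ω | X ω = z} = p z) {c : ι → ℤ} {t s : ℝ} (ht : 0 ≤ t)
    (hs : HasSum (fun z => p z * t ^ c z) s) :
    ∫⁻ ω, ENNReal.ofReal (t ^ c (X ω)) ∂P = ENNReal.ofReal s := by
  rw [← lintegral_map (f := fun z => ENNReal.ofReal (t ^ c z)) .of_discrete hXm,
    lintegral_countable', ← hs.tsum_eq,
    ENNReal.ofReal_tsum_of_nonneg (fun z => mul_nonneg (hp z) (zpow_nonneg ht _)) hs.summable]
  refine tsum_congr fun z => ?_
  have : (P.map X) {z} = ENNReal.ofReal (p z) := by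
    rw [Measure.map_apply hXm (measurableSet_singleton z), ← hX z, ofReal_measureReal]
    rfl
  rw [this, ENNReal.ofReal_mul (hp z), mul_comm]

lemma integral_zpow [IsFiniteMeasure P] {ι : Type*} [Countable ι] [MeasurableSpace ι]
    [MeasurableSingletonClass ι] {p : ι → ℝ} (hp : ∀ z, 0 ≤ p z) {X : Ω → ι} (hXm : Measurable X)
    (hX : ∀ z, P.real {ω | X ω = z} = p z) {c : ι → ℤ} {t s : ℝ} (ht : 0 ≤ t)
    (hs : HasSum (fun z => p z * t ^ c z) s) :
    ∫ ω, t ^ c (X ω) ∂P = s := by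
  have hm : Measurable fun ω => t ^ c (X ω) :=
    (Measurable.of_discrete (f := fun z => t ^ c z)).comp hXm
  rw [integral_eq_lintegral_of_nonneg_ae (Eventually.of_forall fun ω => zpow_nonneg ht _)
    hm.aestronglyMeasurable, lintegral_ofReal_zpow hp hXm hX ht hs,
    ENNReal.toReal_ofReal (hs.nonneg fun z => mul_nonneg (hp z) (zpow_nonneg ht _))]

variable {ξs ηs : ℕ → Ω → ℤ × ℤ} (x : ℤ × ℤ)

/-- The walk at time `m` together with its number of contacts before `m`, as a function of the
driving sequences. -/
noncomputable def walkState (ξ η : ℕ → ℤ × ℤ) (m : ℕ) : (ℤ × ℤ) × ℕ :=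
  (walk ξ η x m, contactsBefore (walk ξ η x) m)

/-- The state at time `m` sees only the driving pairs up to `m`. Factoring through a finite,
countable-valued family gives both measurability and independence from the next pair. -/
lemma exists_walkState_eq (m : ℕ) :
    ∃ F : (Finset.range (m + 1) → (ℤ × ℤ) × (ℤ × ℤ)) → (ℤ × ℤ) × ℕ,
      ∀ ξ η : ℕ → ℤ × ℤ, walkState x ξ η m = F fun k => (ξ k, η k) := by
  refine ⟨fun y => walkState x
    (fun k => if h : k ∈ Finset.range (m + 1) then (y ⟨k, h⟩).1 else 0)
    (fun k => if h : k ∈ Finset.range (m + 1) then (y ⟨k, h⟩).2 else 0) m, fun ξ η => ?_⟩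
  have h : ∀ k ≤ m,
      ξ k = (if h : k ∈ Finset.range (m + 1) then ξ k else 0) ∧
      η k = (if h : k ∈ Finset.range (m + 1) then η k else 0) := fun k hk => by
    have : k ∈ Finset.range (m + 1) := Finset.mem_range.2 (by omega)
    simp [this]
  exact Prod.ext (walk_congr h) (contactsBefore_walk_congr h)

lemma measurable_walkState (hξs : ∀ n, Measurable (ξs n)) (hηs : ∀ n, Measurable (ηs n)) (m : ℕ) :
    Measurable fun ω => walkState x (fun k => ξs k ω) (fun k => ηs k ω) m := by
  obtain ⟨F, hF⟩ := exists_walkState_eq x m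
  simp only [hF]
  exact (Measurable.of_discrete (f := F)).comp
    (measurable_pi_lambda _ fun k => (hξs k).prodMk (hηs k))

lemma indepFun_walkState (hξs : ∀ n, Measurable (ξs n)) (hηs : ∀ n, Measurable (ηs n))
    (hindep : iIndepFun (fun n ω => (ξs n ω, ηs n ω)) P) (m : ℕ) :
    IndepFun (fun ω => walkState x (fun k => ξs k ω) (fun k => ηs k ω) m)
      (fun ω => (ξs (m + 1) ω, ηs (m + 1) ω)) P := by
  obtain ⟨F, hF⟩ := exists_walkState_eq x m
  simp only [hF]
  have h := hindep.indepFun_finset (Finset.range (m + 1)) {m + 1} (by simp)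
    fun n => (hξs n).prodMk (hηs n)
  exact h.comp (φ := F) (ψ := fun y => y ⟨m + 1, Finset.mem_singleton_self _⟩)
    .of_discrete .of_discrete

/-- One step of the walk against a multiplicative weight `W`. -/
lemma lintegral_mul_weight_walk_succ (hξs : ∀ n, Measurable (ξs n)) (hηs : ∀ n, Measurable (ηs n))
    (hindep : iIndepFun (fun n ω => (ξs n ω, ηs n ω)) P)
    {W : ℤ × ℤ → ℝ≥0∞} (hW : ∀ y z, W (y + z) = W y * W z) {A B : ℝ≥0∞} {m : ℕ}
    (hA : ∫⁻ ω, W (ξs (m + 1) ω) ∂P = A) (hB : ∫⁻ ω, W (ηs (m + 1) ω) ∂P = B)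
    (hquad : ∀ᵐ ω ∂P, walk (fun k => ξs k ω) (fun k => ηs k ω) x m ∈ quadrant)
    (G : (ℤ × ℤ) × ℕ → ℝ≥0∞) :
    ∫⁻ ω, G (walkState x (fun k => ξs k ω) (fun k => ηs k ω) m) *
        W (walk (fun k => ξs k ω) (fun k => ηs k ω) x (m + 1)) ∂P =
      ∫⁻ ω, G (walkState x (fun k => ξs k ω) (fun k => ηs k ω) m) *
        (W (walk (fun k => ξs k ω) (fun k => ηs k ω) x m) *
          (interior.indicator (fun _ => A) (walk (fun k => ξs k ω) (fun k => ηs k ω) x m) +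
          boundary.indicator (fun _ => B) (walk (fun k => ξs k ω) (fun k => ηs k ω) x m))) ∂P := by
  set S := fun ω => walkState x (fun k => ξs k ω) (fun k => ηs k ω) m with hS
  have hSm : Measurable S := measurable_walkState x hξs hηs m
  have hind := indepFun_walkState x hξs hηs hindep m
  -- Splitting by region leaves in each part a function of the present state times the weight of the
  -- next step, so the expectation factors. Only independence of the pair from the past matters.
  let F₁ : (ℤ × ℤ) × ℕ → ℝ≥0∞ := fun s => interior.indicator (fun _ => G s * W s.1) s.1
  let F₂ : (ℤ × ℤ) × ℕ → ℝ≥0∞ := fun s => boundary.indicator (fun _ => G s * W s.1) s.1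
  have hF₁ : Measurable fun ω => F₁ (S ω) := (Measurable.of_discrete (f := F₁)).comp hSm
  have hF₂ : Measurable fun ω => F₂ (S ω) := (Measurable.of_discrete (f := F₂)).comp hSm
  have hWξ : Measurable fun ω => W (ξs (m + 1) ω) :=
    (Measurable.of_discrete (f := W)).comp (hξs _)
  have hWη : Measurable fun ω => W (ηs (m + 1) ω) :=
    (Measurable.of_discrete (f := W)).comp (hηs _)
  have h₁ : ∫⁻ ω, F₁ (S ω) * W (ξs (m + 1) ω) ∂P = (∫⁻ ω, F₁ (S ω) ∂P) * A := by
    rw [← hA]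
    exact lintegral_mul_eq_lintegral_mul_lintegral_of_indepFun hF₁ hWξ
      (hind.comp (φ := F₁) (ψ := fun y : (ℤ × ℤ) × (ℤ × ℤ) => W y.1) .of_discrete .of_discrete)
  have h₂ : ∫⁻ ω, F₂ (S ω) * W (ηs (m + 1) ω) ∂P = (∫⁻ ω, F₂ (S ω) ∂P) * B := by
    rw [← hB]
    exact lintegral_mul_eq_lintegral_mul_lintegral_of_indepFun hF₂ hWη
      (hind.comp (φ := F₂) (ψ := fun y : (ℤ × ℤ) × (ℤ × ℤ) => W y.2) .of_discrete .of_discrete)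
  calc _ = ∫⁻ ω, (F₁ (S ω) * W (ξs (m + 1) ω) + F₂ (S ω) * W (ηs (m + 1) ω)) ∂P := by
        refine lintegral_congr_ae ?_
        filter_upwards [hquad] with ω hω
        by_cases h : walk (fun k => ξs k ω) (fun k => ηs k ω) x m ∈ interior
        · have hb : walk (fun k => ξs k ω) (fun k => ηs k ω) x m ∉ boundary := fun hb => hb.2 h
          simp [F₁, F₂, hS, walkState, h, hb, walk_succ_of_mem_interior h, hW, mul_assoc]
        · have hb : walk (fun k => ξs k ω) (fun k => ηs k ω) x m ∈ boundary := ⟨hω, h⟩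
          simp [F₁, F₂, hS, walkState, h, hb, walk_succ_of_mem_boundary hb, hW, mul_assoc]
    _ = ∫⁻ ω, (F₁ (S ω) * A + F₂ (S ω) * B) ∂P := by
        rw [lintegral_add_left (f := fun ω => F₁ (S ω) * W (ξs (m + 1) ω)) (hF₁.mul hWξ),
          lintegral_add_left (hF₁.mul_const _), h₁, h₂,
          lintegral_mul_const _ hF₁, lintegral_mul_const _ hF₂]
    _ = _ := by
        refine lintegral_congr_ae ?_
        filter_upwards [hquad] with ω hω
        by_cases h : walk (fun k => ξs k ω) (fun k => ηs k ω) x m ∈ interior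
        · have hb : walk (fun k => ξs k ω) (fun k => ηs k ω) x m ∉ boundary := fun hb => hb.2 h
          simp [F₁, F₂, hS, walkState, h, hb, mul_assoc]
        · have hb : walk (fun k => ξs k ω) (fun k => ηs k ω) x m ∈ boundary := ⟨hω, h⟩
          simp [F₁, F₂, hS, walkState, h, hb, mul_assoc]

end Expectations

end QuadrantWalk

/-! ### Optional stopping at a given contact -/

namespace QuadrantWalk

section HittingIdentity

variable {Ω : Type*} [MeasurableSpace Ω] {P : Measure Ω} {ξs ηs : ℕ → Ω → ℤ × ℤ} {x : ℤ × ℤ}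

lemma lintegral_weight_walk_le [IsProbabilityMeasure P]
    (hξs : ∀ n, Measurable (ξs n)) (hηs : ∀ n, Measurable (ηs n))
    (hindep : iIndepFun (fun n ω => (ξs n ω, ηs n ω)) P)
    (hquad : ∀ᵐ ω ∂P, ∀ m, walk (fun k => ξs k ω) (fun k => ηs k ω) x m ∈ quadrant)
    {W : ℤ × ℤ → ℝ≥0∞} (hW : ∀ y z, W (y + z) = W y * W z) {ρ : ℝ≥0∞}
    (hA : ∀ m, ∫⁻ ω, W (ξs m ω) ∂P ≤ ρ) (hB : ∀ m, ∫⁻ ω, W (ηs m ω) ∂P ≤ ρ) (m : ℕ) :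
    ∫⁻ ω, W (walk (fun k => ξs k ω) (fun k => ηs k ω) x m) ∂P ≤ W x * ρ ^ m := by
  induction m with
  | zero => simp [walk]
  | succ m ih =>
    have h := lintegral_mul_weight_walk_succ x hξs hηs hindep hW (m := m) rfl rfl
      (hquad.mono fun ω hω => hω m) (fun _ => 1)
    simp only [one_mul] at h
    have hm : Measurable fun ω => W (walk (fun k => ξs k ω) (fun k => ηs k ω) x m) :=
      (Measurable.of_discrete (f := fun s : (ℤ × ℤ) × ℕ => W s.1)).comp
        (measurable_walkState x hξs hηs m)
    rw [h, pow_succ, ← mul_assoc]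
    refine le_trans ?_ (mul_le_mul_left ih ρ)
    rw [← lintegral_mul_const _ hm]
    refine lintegral_mono fun ω => mul_le_mul_right ?_ _
    by_cases hi : walk (fun k => ξs k ω) (fun k => ηs k ω) x m ∈ interior
    · have hb : walk (fun k => ξs k ω) (fun k => ηs k ω) x m ∉ boundary := fun hb => hb.2 hi
      simpa [hi, hb] using hA (m + 1)
    · by_cases hb : walk (fun k => ξs k ω) (fun k => ηs k ω) x m ∈ boundary
      · simpa [hi, hb] using hB (m + 1)
      · simp [hi, hb]

/-- The states at which the contact number `n + 1` takes place. -/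
def contactStates (n : ℕ) : Set ((ℤ × ℤ) × ℕ) := {s | s.1 ∈ boundary ∧ s.2 = n}

/-- The contact number `n + 1` occurs at one time at most, so the events over `m` are disjoint and
their probabilities add up. -/
lemma measure_lt_contacts (hξs : ∀ n, Measurable (ξs n)) (hηs : ∀ n, Measurable (ηs n)) (n : ℕ) :
    P {ω | (n : ℝ≥0∞) < contacts (walk (fun k => ξs k ω) (fun k => ηs k ω) x)} =
      ∑' m, ∫⁻ ω, (contactStates n).indicator 1
        (walkState x (fun k => ξs k ω) (fun k => ηs k ω) m) ∂P := by
  have hmeas : ∀ m, MeasurableSet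
      {ω | walkState x (fun k => ξs k ω) (fun k => ηs k ω) m ∈ contactStates n} :=
    fun m => measurable_walkState x hξs hηs m (MeasurableSet.of_discrete)
  have : {ω | (n : ℝ≥0∞) < contacts (walk (fun k => ξs k ω) (fun k => ηs k ω) x)} =
      ⋃ m, {ω | walkState x (fun k => ξs k ω) (fun k => ηs k ω) m ∈ contactStates n} := by
    ext ω
    simp [lt_contacts_iff, contactStates, walkState]
  rw [this, measure_iUnion]
  · exact tsum_congr fun m => (lintegral_indicator_one (hmeas m)).symm
  · intro k m hkm
    exact Set.disjoint_left.2 fun ω hk hm =>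
      hkm (eq_of_contactsBefore_eq hk.1 hk.2 hm.1 hm.2)
  · exact hmeas

/-- The optional stopping identity at the time of the contact number `n + 1`, for a weight that is
harmonic in the interior and is multiplied by `r` in mean at each boundary step. -/
lemma tsum_lintegral_weight_contactStates [IsProbabilityMeasure P]
    (hξs : ∀ n, Measurable (ξs n)) (hηs : ∀ n, Measurable (ηs n))
    (hindep : iIndepFun (fun n ω => (ξs n ω, ηs n ω)) P)
    (hquad : ∀ᵐ ω ∂P, ∀ m, walk (fun k => ξs k ω) (fun k => ηs k ω) x m ∈ quadrant)
    {W : ℤ × ℤ → ℝ≥0∞} (hW : ∀ y z, W (y + z) = W y * W z) {r : ℝ≥0∞} (hr : r ≤ 1)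
    (hA : ∀ m, ∫⁻ ω, W (ξs m ω) ∂P = 1) (hB : ∀ m, ∫⁻ ω, W (ηs m ω) ∂P = r)
    (hlim : Tendsto (fun m => ∫⁻ ω, W (walk (fun k => ξs k ω) (fun k => ηs k ω) x m) ∂P)
      atTop (nhds 0)) (n : ℕ) :
    ∑' m, ∫⁻ ω, (contactStates n).indicator (fun s => W s.1)
      (walkState x (fun k => ξs k ω) (fun k => ηs k ω) m) ∂P = W x * r ^ n := by
  classical
  -- `U` is the martingale `W * r^(-contacts)` scaled by `r^n` and killed after the contact number
  -- `n + 1`, so only natural powers of `r` occur. `V` is the mass released at that contact; `G` is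
  -- the factor of `U` after the next step, with the count already updated.
  let U : (ℤ × ℤ) × ℕ → ℝ≥0∞ := fun s => if s.2 ≤ n then W s.1 * r ^ (n - s.2) else 0
  let V : (ℤ × ℤ) × ℕ → ℝ≥0∞ := (contactStates n).indicator fun s => W s.1
  let G : (ℤ × ℤ) × ℕ → ℝ≥0∞ := fun s =>
    if s.1 ∈ boundary then (if s.2 + 1 ≤ n then r ^ (n - (s.2 + 1)) else 0)
    else (if s.2 ≤ n then r ^ (n - s.2) else 0)
  let u : ℕ → ℝ≥0∞ := fun m => ∫⁻ ω, U (walkState x (fun k => ξs k ω) (fun k => ηs k ω) m) ∂P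
  let v : ℕ → ℝ≥0∞ := fun m => ∫⁻ ω, V (walkState x (fun k => ξs k ω) (fun k => ηs k ω) m) ∂P
  -- Conservation of mass. In the interior `U` is preserved in mean; at a boundary state with count
  -- below `n` the step's factor `r` restores the lost power; at count `n` all of `U` passes into
  -- `V`; beyond `n` everything is zero.
  have hrec : ∀ m, u m = v m + u (m + 1) := fun m => by
    have hV : Measurable fun ω => V (walkState x (fun k => ξs k ω) (fun k => ηs k ω) m) :=
      (Measurable.of_discrete (f := V)).comp (measurable_walkState x hξs hηs m)
    have hnext : u (m + 1) =
        ∫⁻ ω, G (walkState x (fun k => ξs k ω) (fun k => ηs k ω) m) *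
          W (walk (fun k => ξs k ω) (fun k => ηs k ω) x (m + 1)) ∂P := by
      refine lintegral_congr fun ω => ?_
      by_cases hb : walk (fun k => ξs k ω) (fun k => ηs k ω) x m ∈ boundary
      · simp [U, G, walkState, hb, contactsBefore_succ_of_mem hb, mul_comm]
      · simp [U, G, walkState, hb, contactsBefore_succ_of_notMem hb, mul_comm]
    rw [hnext, lintegral_mul_weight_walk_succ x hξs hηs hindep hW (hA _) (hB _)
      (hquad.mono fun ω hω => hω m), ← lintegral_add_left hV]
    refine lintegral_congr_ae ?_
    filter_upwards [hquad] with ω hω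
    by_cases hi : walk (fun k => ξs k ω) (fun k => ηs k ω) x m ∈ interior
    · have hb : walk (fun k => ξs k ω) (fun k => ηs k ω) x m ∉ boundary := fun hb => hb.2 hi
      simp [U, V, G, walkState, contactStates, hb, hi, mul_comm]
    · have hb : walk (fun k => ξs k ω) (fun k => ηs k ω) x m ∈ boundary := ⟨hω m, hi⟩
      rcases lt_trichotomy (contactsBefore (walk (fun k => ξs k ω) (fun k => ηs k ω) x) m) n
        with h | h | h
      · have hsub : n - contactsBefore (walk (fun k => ξs k ω) (fun k => ηs k ω) x) m =
            n - (contactsBefore (walk (fun k => ξs k ω) (fun k => ηs k ω) x) m + 1) + 1 := by omega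
        simp only [U, V, G, walkState, contactStates, hb, hi, h.le, h.ne, Nat.succ_le_of_lt h,
          Set.indicator, Set.mem_ofPred_eq, if_true, if_false, and_false, zero_add]
        rw [hsub, pow_succ]
        ring
      · simp [U, V, G, walkState, contactStates, hb, hi, h]
      · simp [U, V, G, walkState, contactStates, hb, hi, h.ne', h.not_ge, h.not_gt]
  have hsum : ∀ m, u 0 = ∑ k ∈ Finset.range m, v k + u m := fun m => by
    induction m with
    | zero => simp
    | succ m ih => rw [ih, Finset.sum_range_succ, hrec m, add_assoc]
  -- Since `r ≤ 1`, `U ≤ W`, so no mass remains in the limit.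
  have hu : Tendsto u atTop (nhds 0) := by
    refine tendsto_of_tendsto_of_tendsto_of_le_of_le tendsto_const_nhds hlim (fun _ => zero_le) ?_
    intro m
    refine lintegral_mono fun ω => ?_
    by_cases h : contactsBefore (walk (fun k => ξs k ω) (fun k => ηs k ω) x) m ≤ n
    · simpa [U, walkState, h] using mul_le_of_le_one_right zero_le (pow_le_one₀ zero_le hr)
    · simp [U, walkState, h]
  have hu0 : u 0 = W x * r ^ n := by simp [u, U, walkState, walk, contactsBefore]
  have hlim' := (ENNReal.tendsto_nat_tsum v).add hu
  rw [add_zero] at hlim'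
  rw [← hu0]
  refine tendsto_nhds_unique hlim' ?_
  simp only [← hsum]
  exact tendsto_const_nhds

end HittingIdentity

end QuadrantWalk

/-! ### Exponential weights of a coordinate -/

namespace QuadrantWalk

section Coordinate

/-- The exponential weight `t ^ c z`. -/
noncomputable def expWeight (c : ℤ × ℤ →+ ℤ) (t : ℝ) (z : ℤ × ℤ) : ℝ≥0∞ :=
  ENNReal.ofReal (t ^ c z)

lemma expWeight_add (c : ℤ × ℤ →+ ℤ) {t : ℝ} (ht : 0 < t) (y z : ℤ × ℤ) :
    expWeight c t (y + z) = expWeight c t y * expWeight c t z := by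
  rw [expWeight, expWeight, expWeight, map_add, zpow_add₀ ht.ne',
    ENNReal.ofReal_mul (zpow_nonneg ht.le _)]

lemma expWeight_le_one {c : ℤ × ℤ →+ ℤ} {t : ℝ} (ht : t ∈ Set.Ioo (0 : ℝ) 1) {z : ℤ × ℤ}
    (hz : 0 ≤ c z) : expWeight c t z ≤ 1 :=
  ENNReal.ofReal_le_one.2 (zpow_le_one₀ ht.1 ht.2.le hz)

lemma expWeight_le_expWeight {c : ℤ × ℤ →+ ℤ} {s t : ℝ} (hs : 0 ≤ s) (hst : s ≤ t) {z : ℤ × ℤ}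
    (hz : 0 ≤ c z) : expWeight c s z ≤ expWeight c t z :=
  ENNReal.ofReal_le_ofReal (zpow_le_zpow_left₀ hz hs hst)

lemma expWeight_of_eq_zero {c : ℤ × ℤ →+ ℤ} {t : ℝ} {z : ℤ × ℤ} (hz : c z = 0) :
    expWeight c t z = 1 := by simp [expWeight, hz]

variable {Ω : Type*} [MeasurableSpace Ω] {P : Measure Ω} {ξs ηs : ℕ → Ω → ℤ × ℤ} {x : ℤ × ℤ}

lemma tsum_lintegral_expWeight_contactStates [IsProbabilityMeasure P]
    (hξs : ∀ n, Measurable (ξs n)) (hηs : ∀ n, Measurable (ηs n))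
    (hindep : iIndepFun (fun n ω => (ξs n ω, ηs n ω)) P)
    (hquad : ∀ᵐ ω ∂P, ∀ m, walk (fun k => ξs k ω) (fun k => ηs k ω) x m ∈ quadrant)
    {p q : ℤ × ℤ → ℝ} (hp : ∀ z, 0 ≤ p z) (hq : ∀ z, 0 ≤ q z) (hp1 : HasSum p 1)
    (hq1 : HasSum q 1) (hξp : ∀ n z, P.real {ω | ξs n ω = z} = p z)
    (hηq : ∀ n z, P.real {ω | ηs n ω = z} = q z)
    {c : ℤ × ℤ →+ ℤ} (hc : ∀ z ∈ quadrant, 0 ≤ c z)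
    (hpc : ∀ z, c z ≤ -2 → p z = 0) (hqc : ∀ z, c z ≤ -1 → q z = 0)
    (hpd : Summable (fun z => (c z : ℝ) * p z) ∧ 0 < ∑' z, (c z : ℝ) * p z)
    (hqd : 0 < ∑' z, (c z : ℝ) * q z)
    {t : ℝ} (ht : t ∈ Set.Ioo (0 : ℝ) 1) (hroot : HasSum (fun z => p z * t ^ (c z + 1)) t) :
    ∃ r ∈ Set.Ioo (0 : ℝ) 1, HasSum (fun z => q z * t ^ c z) r ∧
      ∀ n, ∑' m, ∫⁻ ω, (contactStates n).indicator (fun s => expWeight c t s.1)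
        (walkState x (fun k => ξs k ω) (fun k => ηs k ω) m) ∂P =
          ENNReal.ofReal (t ^ c x * r ^ n) := by
  obtain ⟨r, hr, hrs⟩ := exists_hasSum_zpow_mem_Ioo hq hq1 hqc hqd ht
  refine ⟨r, hr, hrs, fun n => ?_⟩
  -- A base `u` above the root `t` for which interior and boundary steps both contract; `W = t^c`
  -- itself does not contract in the interior.
  obtain ⟨u, hu, hu0, s, hs1, hs⟩ := exists_hasSum_zpow_lt_one hp hp1 hpc hpd ht.2
  obtain ⟨s', hs'1, hs'⟩ := exists_hasSum_zpow_mem_Ioo hq hq1 hqc hqd ⟨hu0, hu.2⟩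
  have hone : HasSum (fun z => p z * t ^ c z) 1 := by
    have heq : (fun z => p z * t ^ c z) = fun z => p z * t ^ (c z + 1) / t := funext fun z => by
      rw [zpow_add_one₀ ht.1.ne', ← mul_assoc, mul_div_cancel_right₀ _ ht.1.ne']
    rw [heq, ← div_self ht.1.ne']
    exact hroot.div_const t
  have hρ : ENNReal.ofReal (max s s') < 1 := by
    simpa using And.intro hs1 hs'1.2
  have hdecay := lintegral_weight_walk_le (x := x) hξs hηs hindep hquad (expWeight_add c hu0)
    (ρ := ENNReal.ofReal (max s s'))
    (fun m => (lintegral_ofReal_zpow hp (hξs m) (hξp m) hu0.le hs).le.trans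
      (ENNReal.ofReal_le_ofReal (le_max_left _ _)))
    (fun m => (lintegral_ofReal_zpow hq (hηs m) (hηq m) hu0.le hs').le.trans
      (ENNReal.ofReal_le_ofReal (le_max_right _ _)))
  have hlim : Tendsto (fun m => ∫⁻ ω, expWeight c t
      (walk (fun k => ξs k ω) (fun k => ηs k ω) x m) ∂P) atTop (nhds 0) := by
    have h0 : Tendsto (fun m => expWeight c u x * ENNReal.ofReal (max s s') ^ m) atTop
        (nhds 0) := by
      rw [← mul_zero (expWeight c u x)]
      exact ENNReal.Tendsto.const_mul (ENNReal.tendsto_pow_atTop_nhds_zero_of_lt_one hρ)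
        (Or.inr ENNReal.ofReal_ne_top)
    refine tendsto_of_tendsto_of_tendsto_of_le_of_le tendsto_const_nhds h0 (fun _ => zero_le)
      fun m => le_trans (lintegral_mono_ae ?_) (hdecay m)
    filter_upwards [hquad] with ω hω
    exact expWeight_le_expWeight ht.1.le hu.1.le (hc _ (hω m))
  rw [tsum_lintegral_weight_contactStates hξs hηs hindep hquad (expWeight_add c ht.1)
    (ENNReal.ofReal_le_one.2 hr.2.le)
    (fun m => (lintegral_ofReal_zpow hp (hξs m) (hξp m) ht.1.le hone).trans ENNReal.ofReal_one)
    (fun m => lintegral_ofReal_zpow hq (hηs m) (hηq m) ht.1.le hrs) hlim n,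
    ENNReal.ofReal_mul (zpow_nonneg ht.1.le _), ENNReal.ofReal_pow hr.1.le, expWeight]

lemma tsum_lintegral_indicator_contactStates_le (hξs : ∀ n, Measurable (ξs n))
    (hηs : ∀ n, Measurable (ηs n)) {n : ℕ} {W : ℤ × ℤ → ℝ≥0∞} (hW : ∀ z ∈ boundary, W z ≤ 1) :
    ∑' m, ∫⁻ ω, (contactStates n).indicator (fun s => W s.1)
        (walkState x (fun k => ξs k ω) (fun k => ηs k ω) m) ∂P ≤
      P {ω | (n : ℝ≥0∞) < contacts (walk (fun k => ξs k ω) (fun k => ηs k ω) x)} := by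
  rw [measure_lt_contacts hξs hηs]
  refine ENNReal.tsum_le_tsum fun m => ?_
  refine lintegral_mono fun ω => ?_
  by_cases h : walkState x (fun k => ξs k ω) (fun k => ηs k ω) m ∈ contactStates n
  · rw [Set.indicator_of_mem h, Set.indicator_of_mem h]
    exact hW _ h.1
  · rw [Set.indicator_of_notMem h]
    exact zero_le

lemma measure_lt_contacts_le_add (hξs : ∀ n, Measurable (ξs n))
    (hηs : ∀ n, Measurable (ηs n)) {n : ℕ} {V W : ℤ × ℤ → ℝ≥0∞}
    (hVW : ∀ z ∈ boundary, 1 ≤ V z + W z) :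
    P {ω | (n : ℝ≥0∞) < contacts (walk (fun k => ξs k ω) (fun k => ηs k ω) x)} ≤
      ∑' m, ∫⁻ ω, (contactStates n).indicator (fun s => V s.1)
        (walkState x (fun k => ξs k ω) (fun k => ηs k ω) m) ∂P +
      ∑' m, ∫⁻ ω, (contactStates n).indicator (fun s => W s.1)
        (walkState x (fun k => ξs k ω) (fun k => ηs k ω) m) ∂P := by
  rw [measure_lt_contacts hξs hηs, ← ENNReal.tsum_add]
  refine ENNReal.tsum_le_tsum fun m => ?_
  have hV : Measurable fun ω => (contactStates n).indicator (fun s => V s.1)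
      (walkState x (fun k => ξs k ω) (fun k => ηs k ω) m) :=
    (Measurable.of_discrete (f := (contactStates n).indicator fun s => V s.1)).comp
      (measurable_walkState x hξs hηs m)
  rw [← lintegral_add_left hV]
  refine lintegral_mono fun ω => ?_
  by_cases h : walkState x (fun k => ξs k ω) (fun k => ηs k ω) m ∈ contactStates n
  · simpa [h] using hVW _ h.1
  · rw [Set.indicator_of_notMem h]
    exact zero_le

end Coordinate

end QuadrantWalk
-- Two-sided bound from the two coordinates
theorem mainTheorem2 {Ω : Type*} [MeasurableSpace Ω] (P : Measure Ω) [IsProbabilityMeasure P]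
    (p q : ℤ × ℤ → ℝ) (hpq : QuadrantWalk.Assumptions p q)
    -- random variables with probability mass functions `p` and `q`
    (ξ η : Ω → ℤ × ℤ) (hξ : Measurable ξ) (hη : Measurable η)
    (hξp : ∀ z, P.real {ω | ξ ω = z} = p z) (hηq : ∀ z, P.real {ω | η ω = z} = q z)
    -- sequences of copies; the pairs `(ξs n, ηs n)` are independent for different `n`
    (ξs ηs : ℕ → Ω → ℤ × ℤ)
    (hξs_meas : ∀ n, Measurable (ξs n)) (hηs_meas : ∀ n, Measurable (ηs n))
    (hξs : ∀ n, IdentDistrib (ξs n) ξ P P) (hηs : ∀ n, IdentDistrib (ηs n) η P P)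
    (hindep : iIndepFun (fun n ω => (ξs n ω, ηs n ω)) P) :
    (∃! α : ℝ, QuadrantWalk.IsRootFst p α) ∧ (∃! β : ℝ, QuadrantWalk.IsRootSnd p β) ∧
    ∀ α β : ℝ, QuadrantWalk.IsRootFst p α → QuadrantWalk.IsRootSnd p β →
      ∀ i j : ℕ,
        QuadrantWalk.Asymp
          (fun n => P.real {ω | (n : ℝ≥0∞) < QuadrantWalk.contacts
            (QuadrantWalk.walk (fun m => ξs m ω) (fun m => ηs m ω) ((i : ℤ), (j : ℤ)))})
          (fun n => α ^ i * (∫ ω, α ^ (η ω).1 ∂P) ^ n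
            + β ^ j * (∫ ω, β ^ (η ω).2 ∂P) ^ n) := by
  obtain ⟨k₀, l₀, hkl⟩ := hpq.p_neg
  have hk₀ : 0 < p (k₀, -1) := (hpq.p_nonneg _).lt_of_ne fun h => by simp [← h] at hkl
  have hl₀ : 0 < p (-1, l₀) := (hpq.p_nonneg _).lt_of_ne fun h => by simp [← h] at hkl
  have hp₁ : ∀ z : ℤ × ℤ, z.1 ≤ -2 → p z = 0 := fun z hz => hpq.p_small z.1 z.2 (Or.inl hz)
  have hp₂ : ∀ z : ℤ × ℤ, z.2 ≤ -2 → p z = 0 := fun z hz => hpq.p_small z.1 z.2 (Or.inr hz)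
  have hq₁ : ∀ z : ℤ × ℤ, z.1 ≤ -1 → q z = 0 := fun z hz =>
    hpq.q_nonneg_jumps z.1 z.2 (Or.inl hz)
  have hq₂ : ∀ z : ℤ × ℤ, z.2 ≤ -1 → q z = 0 := fun z hz =>
    hpq.q_nonneg_jumps z.1 z.2 (Or.inr hz)
  refine ⟨QuadrantWalk.existsUnique_zpow_root hpq.p_nonneg hpq.p_sum hp₁ hpq.p_drift_fst
      ⟨(-1, l₀), rfl, hl₀⟩,
    QuadrantWalk.existsUnique_zpow_root hpq.p_nonneg hpq.p_sum hp₂ hpq.p_drift_snd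
      ⟨(k₀, -1), rfl, hk₀⟩, fun α β hα hβ i j => ?_⟩
  have hξps : ∀ n z, P.real {ω | ξs n ω = z} = p z := fun n z => by
    rw [← hξp z, measureReal_def, measureReal_def]
    exact congrArg _ ((hξs n).measure_mem_eq (measurableSet_singleton z))
  have hηqs : ∀ n z, P.real {ω | ηs n ω = z} = q z := fun n z => by
    rw [← hηq z, measureReal_def, measureReal_def]
    exact congrArg _ ((hηs n).measure_mem_eq (measurableSet_singleton z))
  have hquad : ∀ᵐ ω ∂P, ∀ m, QuadrantWalk.walk (fun k => ξs k ω) (fun k => ηs k ω)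
      ((i : ℤ), (j : ℤ)) m ∈ QuadrantWalk.quadrant := by
    filter_upwards [ae_all_iff.2 fun n => QuadrantWalk.ae_ne_zero_of_measureReal_eq (hξps n),
      ae_all_iff.2 fun n => QuadrantWalk.ae_ne_zero_of_measureReal_eq (hηqs n)] with ω h₁ h₂
    refine QuadrantWalk.walk_mem_quadrant ⟨Int.natCast_nonneg i, Int.natCast_nonneg j⟩
      (fun m => ⟨?_, ?_⟩) (fun m => ⟨?_, ?_⟩)
    · by_contra h; exact h₁ m (hp₁ _ (by omega))
    · by_contra h; exact h₁ m (hp₂ _ (by omega))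
    · by_contra h; exact h₂ m (hq₁ _ (by omega))
    · by_contra h; exact h₂ m (hq₂ _ (by omega))
  obtain ⟨a, ha, hsa, hA⟩ := QuadrantWalk.tsum_lintegral_expWeight_contactStates
    hξs_meas hηs_meas hindep hquad hpq.p_nonneg hpq.q_nonneg hpq.p_sum hpq.q_sum hξps hηqs
    (c := AddMonoidHom.fst ℤ ℤ) (fun z hz => hz.1) hp₁ hq₁ hpq.p_drift_fst hpq.q_drift_fst.2
    hα.1 hα.2
  obtain ⟨b, hb, hsb, hB⟩ := QuadrantWalk.tsum_lintegral_expWeight_contactStates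
    hξs_meas hηs_meas hindep hquad hpq.p_nonneg hpq.q_nonneg hpq.p_sum hpq.q_sum hξps hηqs
    (c := AddMonoidHom.snd ℤ ℤ) (fun z hz => hz.2) hp₂ hq₂ hpq.p_drift_snd hpq.q_drift_snd.2
    hβ.1 hβ.2
  have hIa : ∫ ω, α ^ (η ω).1 ∂P = a :=
    QuadrantWalk.integral_zpow hpq.q_nonneg hη hηq (c := Prod.fst) hα.1.1.le hsa
  have hIb : ∫ ω, β ^ (η ω).2 ∂P = b :=
    QuadrantWalk.integral_zpow hpq.q_nonneg hη hηq (c := Prod.snd) hβ.1.1.le hsb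
  simp only [AddMonoidHom.coe_fst, AddMonoidHom.coe_snd, zpow_natCast] at hA hB
  rw [hIa, hIb]
  -- A number above each of two terms is at least half their sum, hence `1 / 2`; the upper constant
  -- is 1. Both bounds hold for every `n`.
  refine ⟨1 / 2, 1, by norm_num, one_pos, Eventually.of_forall fun n => ?_⟩
  have hpa : 0 < α ^ i * a ^ n := mul_pos (pow_pos hα.1.1 _) (pow_pos ha.1 _)
  have hpb : 0 < β ^ j * b ^ n := mul_pos (pow_pos hβ.1.1 _) (pow_pos hb.1 _)
  have hlowa : α ^ i * a ^ n ≤ P.real {ω | (n : ℝ≥0∞) < QuadrantWalk.contacts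
      (QuadrantWalk.walk (fun m => ξs m ω) (fun m => ηs m ω) ((i : ℤ), (j : ℤ)))} := by
    rw [measureReal_def, ← ENNReal.ofReal_le_iff_le_toReal (measure_ne_top P _), ← hA]
    exact QuadrantWalk.tsum_lintegral_indicator_contactStates_le hξs_meas hηs_meas
      fun z hz => QuadrantWalk.expWeight_le_one hα.1 hz.1.1
  have hlowb : β ^ j * b ^ n ≤ P.real {ω | (n : ℝ≥0∞) < QuadrantWalk.contacts
      (QuadrantWalk.walk (fun m => ξs m ω) (fun m => ηs m ω) ((i : ℤ), (j : ℤ)))} := by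
    rw [measureReal_def, ← ENNReal.ofReal_le_iff_le_toReal (measure_ne_top P _), ← hB]
    exact QuadrantWalk.tsum_lintegral_indicator_contactStates_le hξs_meas hηs_meas
      fun z hz => QuadrantWalk.expWeight_le_one hβ.1 hz.1.2
  have hup : P.real {ω | (n : ℝ≥0∞) < QuadrantWalk.contacts
      (QuadrantWalk.walk (fun m => ξs m ω) (fun m => ηs m ω) ((i : ℤ), (j : ℤ)))} ≤
      α ^ i * a ^ n + β ^ j * b ^ n := by
    refine ENNReal.toReal_le_of_le_ofReal (add_pos hpa hpb).le ?_
    rw [ENNReal.ofReal_add hpa.le hpb.le, ← hA, ← hB]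
    refine QuadrantWalk.measure_lt_contacts_le_add hξs_meas hηs_meas fun z hz => ?_
    -- The weight of the vanishing coordinate equals 1, so the two weights sum to at least 1.
    have h : z.1 = 0 ∨ z.2 = 0 := by
      obtain ⟨⟨h₁, h₂⟩, h₃⟩ := hz
      by_contra! h
      exact h₃ ⟨by omega, by omega⟩
    rcases h with h | h
    · rw [QuadrantWalk.expWeight_of_eq_zero (c := AddMonoidHom.fst ℤ ℤ) h]
      exact le_self_add
    · rw [QuadrantWalk.expWeight_of_eq_zero (c := AddMonoidHom.snd ℤ ℤ) h]
      exact le_add_self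
  rw [le_div_iff₀ (add_pos hpa hpb), div_le_iff₀ (add_pos hpa hpb)]
  exact ⟨by linarith, by linarith⟩
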